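/- A Banach lattice is a real Riesz space that is complete for a norm with $|x|\le|y|\Rightarrow\|x\|\le\|y\|$. A Banach sequence lattice $Y$ is a linear space of real sequences that contains every canonical sequence $e_k$, is an ideal (if $g\in Y$ and $|f|\le|g|$ pointwise, then $f\in Y$) and is a Banach space for a norm $\|\cdot\|_Y$ with $\|f\|_Y\le\|g\|_Y$ whenever $f,g\in Y$ and $|f|\le|g|$. Put $\|(t_1,\dots,t_n)\|_{\mathbb R^n,Y}:=\|(t_1,\dots,t_n,0,0,\dots)\|_Y$. Let $\mathcal H_n$ be the space of continuous functions $h:\mathbb R^n\to\mathbb R$ with $h(\lambda t)=\lambda h(t)$ for all $\lambda\ge 0$. For a Banach lattice $X$ and $x=(x_1,\dots,x_n)\in X^n$, let $\tau_{n,x}:\mathcal H_n\to X$ be Krivine's functional calculus, that is, the unique linear map with $\tau_{n,x}(\pi_j)=x_j$ for each coordinate projection $\pi_j$ and $\tau_{n,x}(h_1\vee h_2)=\tau_{n,x}(h_1)\vee\tau_{n,x}(h_2)$ for all $h_1,h_2\in\mathcal H_n$. Put $\|(x_1,\dots,x_n)\|_Y:=\tau_{n,x}(\|\cdot\|_{\mathbb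 R^n,Y})\in X$. Let $X,W$ be Banach lattices. A linear operator $T:X\to W$ is positive if $Tx\ge 0$ for all $x\ge0$, it is regular if it is a difference of two positive linear operators, and it is $Y$-regular if there is a constant $C>0$ with $$\big\|\,\|(Tx_1,\dots,Tx_n)\|_Y\,\big\|_W\le C\,\big\|\,\|(x_1,\dots,x_n)\|_Y\,\big\|_X\qquad\text{for all } n \text{ and all } x_1,\dots,x_n\in X.$$ Proposition. Let $Y$ be a Banach sequence lattice and let $X,W$ be Banach lattices. Then every regular operator $T:X\to W$ is $Y$-regular, that is, $\mathcal L_r(X,W)\subset\Lambda_Y(X,W)$. Moreover, for every positive linear operator $P:X\to W$, all $n$ and all $x_1,\dots,x_n\in X$, $$\|(Px_1,\dots,Px_n)\|_Y\le P\big(\|(x_1,\dots,x_n)\|_Y\big)\quad\text{in } W.$$ -/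

import Mathlib

open Filter Topology
set_option linter.unusedSectionVars false

namespace Krivine

/-- `H_n`: the continuous functions `h : ℝⁿ → ℝ` with `h (c t) = c h t` for all `c ≥ 0`. -/
def HomogFun (n : ℕ) : Submodule ℝ C(Fin n → ℝ, ℝ) where
  carrier := {h | ∀ c : ℝ, 0 ≤ c → ∀ t : Fin n → ℝ, h (c • t) = c * h t}
  add_mem' := by
    intro f g hf hg c hc t
    simp [hf c hc t, hg c hc t, mul_add]
  zero_mem' := by
    intro c _ t
    simp
  smul_mem' := by
    intro r f hf c hc t
    simp [hf c hc t, mul_left_comm]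

namespace HomogFun

variable {n : ℕ}

/-- The pointwise maximum `h₁ ∨ h₂`. -/
def sup (h₁ h₂ : HomogFun n) : HomogFun n :=
  ⟨(h₁ : C(Fin n → ℝ, ℝ)) ⊔ (h₂ : C(Fin n → ℝ, ℝ)), by
    intro c hc t
    simp only [ContinuousMap.sup_apply, h₁.2 c hc t, h₂.2 c hc t]
    exact (mul_max_of_nonneg _ _ hc).symm⟩

/-- The coordinate projection `π_j : ℝⁿ → ℝ`. -/
def proj (j : Fin n) : HomogFun n :=
  ⟨⟨fun t => t j, continuous_apply j⟩, by intro c _ t; simp⟩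

end HomogFun

section Calculus

variable {X : Type*} [NormedAddCommGroup X] [NormedSpace ℝ X] [Lattice X]
  [IsOrderedAddMonoid X] [IsOrderedModule ℝ X] [HasSolidNorm X]
variable {n : ℕ}

/-- The two properties that characterize Krivine's functional calculus at `x ∈ Xⁿ`. -/
structure IsCalculus (x : Fin n → X) (τ : HomogFun n →ₗ[ℝ] X) : Prop where
  map_proj : ∀ j, τ (HomogFun.proj j) = x j
  map_sup : ∀ h₁ h₂, τ (HomogFun.sup h₁ h₂) = τ h₁ ⊔ τ h₂

/- Existence and uniqueness of the calculus. -/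

/-- The unit sphere of the maximum norm. -/
abbrev Sph (n : ℕ) := Metric.sphere (0 : Fin n → ℝ) 1

def res (n : ℕ) : HomogFun n →ₗ[ℝ] C(Sph n, ℝ) where
  toFun h := (h : C(Fin n → ℝ, ℝ)).restrict (Sph n)
  map_add' _ _ := rfl
  map_smul' _ _ := rfl

def gen (x : Fin n → X) (j : Fin n) : C(Sph n, ℝ) × X := (res n (HomogFun.proj j), x j)

def linSet (x : Fin n → X) : Set (C(Sph n, ℝ) × X) :=
  Set.range (Fintype.linearCombination ℝ (gen x))

def latSet (x : Fin n → X) : Set (C(Sph n, ℝ) × X) := latticeClosure (linSet x)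


theorem linSet_subset (x : Fin n → X) : linSet x ⊆ latSet x := subset_latticeClosure

theorem latSet_sup (x : Fin n → X) {p q : C(Sph n, ℝ) × X} (hp : p ∈ latSet x)
    (hq : q ∈ latSet x) : p ⊔ q ∈ latSet x := isSublattice_latticeClosure.supClosed hp hq

theorem latSet_inf (x : Fin n → X) {p q : C(Sph n, ℝ) × X} (hp : p ∈ latSet x)
    (hq : q ∈ latSet x) : p ⊓ q ∈ latSet x := isSublattice_latticeClosure.infClosed hp hq

theorem latSet_add (x : Fin n → X) {p q : C(Sph n, ℝ) × X} (hp : p ∈ latSet x)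
    (hq : q ∈ latSet x) : p + q ∈ latSet x := by
  have key : ∀ a : C(Sph n, ℝ) × X, ∀ s : Set (C(Sph n, ℝ) × X), s ⊆ {b | a + b ∈ latSet x} →
      latticeClosure s ⊆ {b | a + b ∈ latSet x} := by
    intro a s hs
    refine latticeClosure_min hs ⟨?_, ?_⟩
    · intro b hb c hc
      simp only [Set.mem_ofPred_eq] at *
      rw [add_sup]
      exact latSet_sup x hb hc
    · intro b hb c hc
      simp only [Set.mem_ofPred_eq] at *
      rw [add_inf]
      exact latSet_inf x hb hc
  have h1 : ∀ a ∈ linSet x, ∀ b ∈ latSet x, a + b ∈ latSet x := by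
    intro a ha b hb
    refine key a (linSet x) ?_ hb
    intro c hc
    obtain ⟨v, rfl⟩ := ha
    obtain ⟨w, rfl⟩ := hc
    exact linSet_subset x ⟨v + w, map_add _ _ _⟩
  refine key p (linSet x) ?_ hq
  intro c hc
  have := h1 c hc p hp
  rwa [add_comm] at this

theorem latSet_neg (x : Fin n → X) {p : C(Sph n, ℝ) × X} (hp : p ∈ latSet x) :
    -p ∈ latSet x := by
  refine (latticeClosure_min (t := {b | -b ∈ latSet x}) ?_ ⟨?_, ?_⟩) hp
  · rintro _ ⟨v, rfl⟩
    exact linSet_subset x ⟨-v, map_neg _ _⟩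
  · intro b hb c hc
    simp only [Set.mem_ofPred_eq] at *
    rw [neg_sup]
    exact latSet_inf x hb hc
  · intro b hb c hc
    simp only [Set.mem_ofPred_eq] at *
    rw [neg_inf]
    exact latSet_sup x hb hc

theorem latSet_sub (x : Fin n → X) {p q : C(Sph n, ℝ) × X} (hp : p ∈ latSet x)
    (hq : q ∈ latSet x) : p - q ∈ latSet x := by
  rw [sub_eq_add_neg]
  exact latSet_add x hp (latSet_neg x hq)

theorem smul_sup_X {c : ℝ} (hc : 0 < c) (a b : X) : c • (a ⊔ b) = c • a ⊔ c • b :=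
  map_sup (OrderIso.smulRight (β := X) hc) a b

theorem smul_inf_X {c : ℝ} (hc : 0 < c) (a b : X) : c • (a ⊓ b) = c • a ⊓ c • b :=
  map_inf (OrderIso.smulRight (β := X) hc) a b

theorem latSet_smul_pos (x : Fin n → X) {c : ℝ} (hc : 0 < c) {p : C(Sph n, ℝ) × X}
    (hp : p ∈ latSet x) : c • p ∈ latSet x := by
  refine (latticeClosure_min (t := {b | c • b ∈ latSet x}) ?_ ⟨?_, ?_⟩) hp
  · rintro _ ⟨v, rfl⟩
    exact linSet_subset x ⟨c • v, map_smul _ _ _⟩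
  · intro b hb d hd
    have : c • (b ⊔ d) = c • b ⊔ c • d := by
      refine Prod.ext ?_ (smul_sup_X hc _ _)
      ext s
      exact mul_max_of_nonneg _ _ hc.le
    simp only [Set.mem_ofPred_eq] at *
    rw [this]
    exact latSet_sup x hb hd
  · intro b hb d hd
    have : c • (b ⊓ d) = c • b ⊓ c • d := by
      refine Prod.ext ?_ (smul_inf_X hc _ _)
      ext s
      exact mul_min_of_nonneg _ _ hc.le
    simp only [Set.mem_ofPred_eq] at *
    rw [this]
    exact latSet_inf x hb hd

theorem latSet_smul (x : Fin n → X) (c : ℝ) {p : C(Sph n, ℝ) × X}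
    (hp : p ∈ latSet x) : c • p ∈ latSet x := by
  rcases lt_trichotomy c 0 with h | h | h
  · have := latSet_neg x (latSet_smul_pos x (neg_pos.2 h) hp)
    simpa using this
  · subst h
    rw [zero_smul]
    exact linSet_subset x ⟨0, map_zero _⟩
  · exact latSet_smul_pos x h hp

theorem latticeClosure_subset_inf_sup {α : Type*} [AddCommGroup α] [Lattice α]
    [IsOrderedAddMonoid α] (s : Set α) : latticeClosure s ⊆ infClosure (supClosure s) := by
  let _ : DistribLattice α := AddCommGroup.toDistribLattice α
  exact (infClosure_supClosure s).ge

theorem linComb_fst (x : Fin n → X) (v : Fin n → ℝ) (s : Sph n) :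
    (Fintype.linearCombination ℝ (gen x) v).1 s = ∑ j, v j * (s : Fin n → ℝ) j := by
  simp only [Fintype.linearCombination_apply, Prod.fst_sum, ContinuousMap.sum_apply]
  rfl

/-- If a finite supremum of linear forms is nonnegative, so is its counterpart in `X`. -/
theorem sup_nonneg (x : Fin n → X) (u : Finset (C(Sph n, ℝ) × X)) (hu : u.Nonempty)
    (hus : (u : Set (C(Sph n, ℝ) × X)) ⊆ linSet x) (h : 0 ≤ (u.sup' hu id).1) :
    0 ≤ (u.sup' hu id).2 := by
  classical
  rw [linSet, ← Set.image_univ, Finset.subset_set_image_iff] at hus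
  obtain ⟨V, -, rfl⟩ := hus
  set Φ := Fintype.linearCombination ℝ (gen x) with hΦ
  set Y := ((V.image Φ).sup' hu id) with hY
  have hle : ∀ v ∈ V, Φ v ≤ Y := fun v hv =>
    Finset.le_sup' (f := id) (Finset.mem_image_of_mem Φ hv)
  have h0 : (0 : Fin n → ℝ) ∈ convexHull ℝ (V : Set (Fin n → ℝ)) := by
    by_contra hcon
    obtain ⟨f, r, hr, hf⟩ := geometric_hahn_banach_point_closed (convex_convexHull ℝ _)
      (V.finite_toSet.isClosed_convexHull ℝ) hcon
    rw [map_zero] at hr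
    have hf' : ∀ v ∈ V, 0 < f v := fun v hv => hr.trans (hf v (subset_convexHull ℝ _ hv))
    let t : Fin n → ℝ := fun j => - f (Pi.single j 1)
    have hft : ∀ v, f v = - ∑ j, v j * t j := by
      intro v
      conv_lhs => rw [pi_eq_sum_univ' v]
      simp [t, Finset.sum_neg_distrib]
    obtain ⟨v0, hv0⟩ : V.Nonempty := by simpa using hu
    have ht : t ≠ 0 := by
      intro h0
      have := hf' v0 hv0
      rw [hft, h0] at this
      simp at this
    have htn : 0 < ‖t‖ := norm_pos_iff.2 ht
    let s : Sph n := ⟨‖t‖⁻¹ • t, by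
      rw [mem_sphere_zero_iff_norm, norm_smul, norm_inv, norm_norm, inv_mul_cancel₀ htn.ne']⟩
    have hs : ∀ v ∈ V, (Φ v).1 s < 0 := by
      intro v hv
      rw [linComb_fst]
      have : ∑ j, v j * (s : Fin n → ℝ) j = ‖t‖⁻¹ * ∑ j, v j * t j := by
        rw [Finset.mul_sum]
        refine Finset.sum_congr rfl fun j _ => ?_
        simp only [s, Pi.smul_apply, smul_eq_mul]
        ring
      rw [this]
      have h1 := hf' v hv
      rw [hft] at h1
      exact mul_neg_of_pos_of_neg (inv_pos.2 htn) (by linarith)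
    have hYs : Y.1 s < 0 := by
      have e : Y.1 s = (V.image Φ).sup' hu ((fun q : C(Sph n, ℝ) × X => q.1 s) ∘ id) :=
        Finset.apply_sup'_eq_sup'_comp hu (fun q : C(Sph n, ℝ) × X => q.1 s)
          (fun a b => rfl)
      rw [e, Finset.sup'_lt_iff]
      intro q hq
      obtain ⟨v, hv, rfl⟩ := Finset.mem_image.1 hq
      exact hs v hv
    exact absurd (h s) (not_le.2 hYs)
  have hconv : Convex ℝ {v : Fin n → ℝ | (Φ v).2 ≤ Y.2} := by
    intro a ha b hb α β hα hβ hαβ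
    simp only [Set.mem_ofPred_eq, map_add, map_smul, Prod.snd_add, Prod.smul_snd] at *
    calc α • (Φ a).2 + β • (Φ b).2 ≤ α • Y.2 + β • Y.2 :=
          add_le_add (smul_le_smul_of_nonneg_left ha hα) (smul_le_smul_of_nonneg_left hb hβ)
      _ = Y.2 := by rw [← add_smul, hαβ, one_smul]
  have key : (Φ 0).2 ≤ Y.2 := convexHull_min (fun v hv => (hle v hv).2) hconv h0
  rwa [map_zero] at key

theorem latSet_nonneg (x : Fin n → X) {p : C(Sph n, ℝ) × X} (hp : p ∈ latSet x)
    (h : 0 ≤ p.1) : 0 ≤ p.2 := by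
  obtain ⟨t, ht, hts, rfl⟩ := latticeClosure_subset_inf_sup _ hp
  have : ((t.inf' ht id).1, (0 : X)) ≤ t.inf' ht id := by
    refine Finset.le_inf' ht _ fun q hq => ?_
    have hle : t.inf' ht id ≤ q := Finset.inf'_le id hq
    refine ⟨hle.1, ?_⟩
    obtain ⟨u, hu, hus, rfl⟩ := hts hq
    exact sup_nonneg x u hu hus (h.trans hle.1)
  exact this.2

theorem latSet_gen (x : Fin n → X) (j : Fin n) : gen x j ∈ latSet x := by
  classical
  exact linSet_subset x ⟨Pi.single j 1, by simp [Fintype.linearCombination_apply_single]⟩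

/-- `(1, e)` with `e` the supremum of the `|x_j|` belongs to the graph. -/
theorem exists_unit (x : Fin n → X) : ∃ e : X, ((1 : C(Sph n, ℝ)), e) ∈ latSet x := by
  rcases Nat.eq_zero_or_pos n with rfl | hn
  · refine ⟨0, ?_⟩
    have : ((1 : C(Sph 0, ℝ)), (0 : X)) = 0 := by
      refine Prod.ext ?_ rfl
      ext s
      have h1 : ‖(s : Fin 0 → ℝ)‖ = 1 := mem_sphere_zero_iff_norm.1 s.2
      rw [Subsingleton.elim (s : Fin 0 → ℝ) 0, norm_zero] at h1
      exact absurd h1 zero_ne_one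
    rw [this]
    exact linSet_subset x ⟨0, map_zero _⟩
  · have : Nonempty (Fin n) := ⟨⟨0, hn⟩⟩
    let q := Finset.univ.sup' Finset.univ_nonempty fun j => gen x j ⊔ -gen x j
    have hq : q ∈ latSet x := (isSublattice_latticeClosure.supClosed).finsetSup'_mem _
      fun j _ => latSet_sup x (latSet_gen x j) (latSet_neg x (latSet_gen x j))
    refine ⟨q.2, ?_⟩
    have : q.1 = 1 := by
      ext s
      have e : q.1 s = Finset.univ.sup' Finset.univ_nonempty
          ((fun q : C(Sph n, ℝ) × X => q.1 s) ∘ fun j => gen x j ⊔ -gen x j) :=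
        Finset.apply_sup'_eq_sup'_comp _ (fun q : C(Sph n, ℝ) × X => q.1 s) (fun a b => rfl)
      have e2 : ((fun q : C(Sph n, ℝ) × X => q.1 s) ∘ fun j => gen x j ⊔ -gen x j) =
          fun j => ‖(s : Fin n → ℝ) j‖ := by
        funext j
        rfl
      have h1 : ‖(s : Fin n → ℝ)‖ = 1 := mem_sphere_zero_iff_norm.1 s.2
      rw [e, e2, ContinuousMap.one_apply]
      refine le_antisymm (Finset.sup'_le _ _ fun j _ => (norm_le_pi_norm _ j).trans h1.le) ?_
      rw [← h1]
      refine (pi_norm_le_iff_of_nonempty _).2 fun j => ?_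
      exact Finset.le_sup' (fun j => ‖(s : Fin n → ℝ) j‖) (Finset.mem_univ j)
    rw [← this]
    exact hq

theorem latSet_bound (x : Fin n → X) :
    ∃ M : ℝ, 0 ≤ M ∧ ∀ p ∈ latSet x, ‖p.2‖ ≤ M * ‖p.1‖ := by
  obtain ⟨e, he⟩ := exists_unit x
  refine ⟨‖e‖, norm_nonneg _, fun p hp => ?_⟩
  have hb : ∀ q ∈ latSet x, q.2 ≤ ‖q.1‖ • e := by
    intro q hq
    have := latSet_nonneg x (latSet_sub x (latSet_smul x ‖q.1‖ he) hq) (by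
      intro s
      have := (le_abs_self _).trans (q.1.norm_coe_le_norm s)
      simpa using this)
    simpa using this
  have h1 := hb p hp
  have h2 := hb (-p) (latSet_neg x hp)
  simp only [Prod.snd_neg, Prod.fst_neg, norm_neg] at h2
  have h3 : |p.2| ≤ |‖p.1‖ • e| := (sup_le h1 h2).trans (le_abs_self _)
  have := HasSolidNorm.solid h3
  rwa [norm_smul, norm_norm, mul_comm] at this

/-- Density of a sublattice that contains the constants and the projections. -/
theorem dense_of_lattice (L : Set C(Sph n, ℝ))
    (hlin : ∀ (a b : ℝ) (j : Fin n), a • (1 : C(Sph n, ℝ)) + b • res n (HomogFun.proj j) ∈ L)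
    (h0 : (0 : C(Sph n, ℝ)) ∈ L)
    (hinf : ∀ᵉ (f ∈ L) (g ∈ L), f ⊓ g ∈ L) (hsup : ∀ᵉ (f ∈ L) (g ∈ L), f ⊔ g ∈ L) :
    closure L = ⊤ := by
  refine ContinuousMap.sublattice_closure_eq_top L ⟨0, h0⟩ hinf hsup ?_
  intro v s t
  have hj : Nonempty (Fin n) := by
    by_contra hne
    rw [not_nonempty_iff] at hne
    have h1 : ‖(s : Fin n → ℝ)‖ = 1 := mem_sphere_zero_iff_norm.1 s.2
    rw [Subsingleton.elim (s : Fin n → ℝ) 0, norm_zero] at h1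
    exact zero_ne_one h1
  by_cases hst : s = t
  · subst hst
    refine ⟨_, hlin (v s) 0 hj.some, ?_⟩
    simp
  · obtain ⟨j, hj⟩ : ∃ j, (s : Fin n → ℝ) j ≠ (t : Fin n → ℝ) j := by
      by_contra hcon
      push Not at hcon
      exact hst (Subtype.ext (funext hcon))
    have hd : (s : Fin n → ℝ) j - (t : Fin n → ℝ) j ≠ 0 := sub_ne_zero.2 hj
    have hev : ∀ r : Sph n, res n (HomogFun.proj j) r = (r : Fin n → ℝ) j := fun _ => rfl
    refine ⟨_, hlin (v s - (v s - v t) / ((s : Fin n → ℝ) j - (t : Fin n → ℝ) j) *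
      (s : Fin n → ℝ) j) ((v s - v t) / ((s : Fin n → ℝ) j - (t : Fin n → ℝ) j)) j, ?_, ?_⟩
    · simp [hev]
    · simp only [ContinuousMap.add_apply, ContinuousMap.smul_apply, ContinuousMap.one_apply, hev,
        smul_eq_mul, mul_one]
      field_simp
      ring

theorem latSet_dense (x : Fin n → X) : closure (Prod.fst '' latSet x) = ⊤ := by
  obtain ⟨e, he⟩ := exists_unit x
  refine dense_of_lattice _ ?_ ?_ ?_ ?_
  · intro a b j
    exact ⟨_, latSet_add x (latSet_smul x a he) (latSet_smul x b (latSet_gen x j)), rfl⟩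
  · exact ⟨0, linSet_subset x ⟨0, map_zero _⟩, rfl⟩
  · rintro _ ⟨p, hp, rfl⟩ _ ⟨q, hq, rfl⟩
    exact ⟨_, latSet_inf x hp hq, rfl⟩
  · rintro _ ⟨p, hp, rfl⟩ _ ⟨q, hq, rfl⟩
    exact ⟨_, latSet_sup x hp hq, rfl⟩

theorem closure_unique (x : Fin n → X) {f : C(Sph n, ℝ)} {y z : X}
    (hy : (f, y) ∈ closure (latSet x)) (hz : (f, z) ∈ closure (latSet x)) : y = z := by
  obtain ⟨M, hM, hb⟩ := latSet_bound x
  have hcl : closure (latSet x) ⊆ {p | ‖p.2‖ ≤ M * ‖p.1‖} :=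
    closure_minimal hb (isClosed_le (by fun_prop) (by fun_prop))
  have hsub : (f, y) - (f, z) ∈ closure (latSet x) :=
    map_mem_closure₂ continuous_sub hy hz fun p hp q hq => latSet_sub x hp hq
  have := hcl hsub
  simpa [sub_eq_zero] using this

theorem closure_exists [CompleteSpace X] (x : Fin n → X) (f : C(Sph n, ℝ)) :
    ∃ y, (f, y) ∈ closure (latSet x) := by
  obtain ⟨M, hM, hb⟩ := latSet_bound x
  have hf : f ∈ closure (Prod.fst '' latSet x) := by
    rw [latSet_dense]
    trivial
  obtain ⟨g, hg, hgf⟩ := mem_closure_iff_seq_limit.1 hf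
  choose p hp hpg using hg
  have hgc : CauchySeq g := hgf.cauchySeq
  have hyc : CauchySeq fun k => (p k).2 := by
    rw [Metric.cauchySeq_iff] at hgc ⊢
    intro ε hε
    obtain ⟨N, hN⟩ := hgc (ε / (M + 1)) (by positivity)
    refine ⟨N, fun a ha b hb' => ?_⟩
    have h1 := hN a ha b hb'
    rw [dist_eq_norm, lt_div_iff₀ (by positivity)] at h1
    have h2 := hb _ (latSet_sub x (hp a) (hp b))
    rw [Prod.snd_sub, Prod.fst_sub, hpg, hpg] at h2
    rw [dist_eq_norm]
    nlinarith [norm_nonneg (g a - g b)]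
  obtain ⟨y, hy⟩ := cauchySeq_tendsto_of_complete hyc
  refine ⟨y, mem_closure_iff_seq_limit.2 ⟨p, hp, ?_⟩⟩
  have : Tendsto (fun k => ((p k).1, (p k).2)) atTop (𝓝 (f, y)) := by
    refine Tendsto.prodMk_nhds ?_ hy
    simpa only [hpg] using hgf
  exact this

theorem continuous_sup_pair :
    Continuous fun p : (C(Sph n, ℝ) × X) × (C(Sph n, ℝ) × X) => p.1 ⊔ p.2 := by
  have : HasSolidNorm C(Sph n, ℝ) := ⟨fun f g h =>
    (ContinuousMap.norm_le f (norm_nonneg g)).2 fun s =>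
      (show ‖f s‖ ≤ ‖g s‖ from h s).trans (g.norm_coe_le_norm s)⟩
  have h1 : Continuous fun p : (C(Sph n, ℝ) × X) × (C(Sph n, ℝ) × X) => p.1.1 ⊔ p.2.1 :=
    (continuous_fst.comp continuous_fst).sup (continuous_fst.comp continuous_snd)
  have h2 : Continuous fun p : (C(Sph n, ℝ) × X) × (C(Sph n, ℝ) × X) => p.1.2 ⊔ p.2.2 :=
    (continuous_snd.comp continuous_fst).sup (continuous_snd.comp continuous_snd)
  exact h1.prodMk h2

theorem exists_isCalculus [CompleteSpace X] (x : Fin n → X) :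
    ∃ τ : HomogFun n →ₗ[ℝ] X, IsCalculus x τ := by
  choose T hT using closure_exists x
  have huniq : ∀ f y, (f, y) ∈ closure (latSet x) → T f = y := fun f y h =>
    closure_unique x (hT f) h
  refine ⟨{ toFun := fun h => T (res n h), map_add' := ?_, map_smul' := ?_ }, ?_, ?_⟩
  · intro h k
    refine huniq _ _ ?_
    rw [map_add]
    exact map_mem_closure₂ (f := fun p q : C(Sph n, ℝ) × X => p + q) continuous_add (hT _) (hT _)
      fun p hp q hq => latSet_add x hp hq
  · intro c h
    refine huniq _ _ ?_
    rw [map_smul]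
    exact map_mem_closure (f := fun p : C(Sph n, ℝ) × X => c • p) (continuous_const_smul c) (hT _)
      fun p hp => latSet_smul x c hp
  · intro j
    exact huniq _ _ (subset_closure (latSet_gen x j))
  · intro h k
    refine huniq _ _ ?_
    exact map_mem_closure₂ (f := fun p q : C(Sph n, ℝ) × X => p ⊔ q) continuous_sup_pair
      (hT (res n h)) (hT (res n k))
      fun p hp q hq => latSet_sup x hp hq

/-- The maximum norm as an element of `H_n`. -/
def maxFun (n : ℕ) : HomogFun n :=
  ⟨⟨fun t => ‖t‖, continuous_norm⟩, by
    intro c hc t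
    simp [norm_smul, abs_of_nonneg hc]⟩

theorem IsCalculus.nonneg {x : Fin n → X} {τ : HomogFun n →ₗ[ℝ] X} (h : IsCalculus x τ)
    {f : HomogFun n} (hf : ∀ t, 0 ≤ (f : C(Fin n → ℝ, ℝ)) t) : 0 ≤ τ f := by
  have e : HomogFun.sup f 0 = f := by
    refine Subtype.ext (ContinuousMap.ext fun t => ?_)
    exact max_eq_left (hf t)
  have := h.map_sup f 0
  rw [e, map_zero] at this
  exact left_eq_sup.1 this

theorem homog_le {f : HomogFun n} {c : ℝ} (h : ∀ s : Sph n, res n f s ≤ c) (t : Fin n → ℝ) :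
    (f : C(Fin n → ℝ, ℝ)) t ≤ c * ‖t‖ := by
  by_cases ht : t = 0
  · subst ht
    have := f.2 0 le_rfl 0
    simp only [zero_smul, zero_mul] at this
    simp [this]
  · have htn : 0 < ‖t‖ := norm_pos_iff.2 ht
    have h1 : (f : C(Fin n → ℝ, ℝ)) (‖t‖⁻¹ • t) ≤ c := h ⟨‖t‖⁻¹ • t, by
      rw [mem_sphere_zero_iff_norm, norm_smul, norm_inv, norm_norm, inv_mul_cancel₀ htn.ne']⟩
    rw [f.2 _ (inv_nonneg.2 htn.le), inv_mul_le_iff₀ htn] at h1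
    linarith

theorem IsCalculus.norm_le {x : Fin n → X} {τ : HomogFun n →ₗ[ℝ] X} (h : IsCalculus x τ)
    (f : HomogFun n) : ‖τ f‖ ≤ ‖res n f‖ * ‖τ (maxFun n)‖ := by
  have hle : ∀ g : HomogFun n, τ g ≤ ‖res n g‖ • τ (maxFun n) := by
    intro g
    have : 0 ≤ τ (‖res n g‖ • maxFun n - g) := h.nonneg fun t => by
      have := homog_le (fun s => (le_abs_self _).trans ((res n g).norm_coe_le_norm s)) t
      exact sub_nonneg.2 this
    simpa using this
  have h1 := hle f
  have h2 := hle (-f)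
  simp only [map_neg, norm_neg] at h2
  have := HasSolidNorm.solid ((sup_le h1 h2).trans (le_abs_self _))
  rwa [norm_smul, norm_norm] at this

theorem IsCalculus.lift {x : Fin n → X} {τ : HomogFun n →ₗ[ℝ] X} (h : IsCalculus x τ)
    {p : C(Sph n, ℝ) × X} (hp : p ∈ latSet x) : ∃ f : HomogFun n, (res n f, τ f) = p := by
  refine (latticeClosure_min (t := {p | ∃ f : HomogFun n, (res n f, τ f) = p}) ?_ ⟨?_, ?_⟩) hp
  · rintro _ ⟨v, rfl⟩
    refine ⟨∑ j, v j • HomogFun.proj j, ?_⟩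
    simp only [map_sum, map_smul, Fintype.linearCombination_apply, h.map_proj]
    refine Prod.ext ?_ ?_
    · simp [Prod.fst_sum, gen]
    · simp [Prod.snd_sum, gen]
  · rintro _ ⟨f, rfl⟩ _ ⟨g, rfl⟩
    exact ⟨HomogFun.sup f g, Prod.ext rfl (h.map_sup f g)⟩
  · rintro _ ⟨f, rfl⟩ _ ⟨g, rfl⟩
    refine ⟨-HomogFun.sup (-f) (-g), ?_⟩
    have e : (res n f, τ f) ⊓ (res n g, τ g) =
        -((-(res n f, τ f)) ⊔ (-(res n g, τ g))) := by
      rw [neg_sup, neg_neg, neg_neg]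
    rw [e]
    refine Prod.ext rfl ?_
    simp only [map_neg, h.map_sup, Prod.snd_neg, Prod.snd_sup]

theorem IsCalculus.mem_closure {x : Fin n → X} {τ : HomogFun n →ₗ[ℝ] X} (h : IsCalculus x τ)
    (f : HomogFun n) : (res n f, τ f) ∈ closure (latSet x) := by
  have hf : res n f ∈ closure (Prod.fst '' latSet x) := by
    rw [latSet_dense]
    trivial
  obtain ⟨g, hg, hgf⟩ := mem_closure_iff_seq_limit.1 hf
  choose p hp hpg using hg
  choose k hk using fun i => h.lift (hp i)
  have hgk : ∀ i, g i = res n (k i) := fun i => by rw [← hpg, ← hk]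
  refine mem_closure_iff_seq_limit.2 ⟨p, hp, ?_⟩
  have hτ : Tendsto (fun i => τ (k i)) atTop (𝓝 (τ f)) := by
    rw [tendsto_iff_norm_sub_tendsto_zero] at hgf ⊢
    have hz : Tendsto (fun i => ‖g i - res n f‖ * ‖τ (maxFun n)‖) atTop (𝓝 0) := by
      simpa using hgf.mul_const ‖τ (maxFun n)‖
    refine squeeze_zero (fun _ => norm_nonneg _) (fun i => ?_) hz
    rw [hgk, ← map_sub, ← map_sub]
    exact h.norm_le _
  have : Tendsto (fun i => (res n (k i), τ (k i))) atTop (𝓝 (res n f, τ f)) := by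
    refine Tendsto.prodMk_nhds ?_ hτ
    exact hgf.congr hgk
  simpa only [hk] using this

/-- Krivine's theorem: existence and uniqueness of the calculus in a Banach lattice. -/
theorem existsUnique_isCalculus [CompleteSpace X] (x : Fin n → X) :
    ∃! τ : HomogFun n →ₗ[ℝ] X, IsCalculus x τ := by
  obtain ⟨τ, hτ⟩ := exists_isCalculus x
  refine ⟨τ, hτ, fun σ hσ => LinearMap.ext fun f => ?_⟩
  exact closure_unique x (hσ.mem_closure f) (hτ.mem_closure f)

/-- Krivine's functional calculus `τ_{n,x} : H_n → X`. -/
noncomputable def calculus [CompleteSpace X] (x : Fin n → X) : HomogFun n →ₗ[ℝ] X :=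
  (existsUnique_isCalculus x).choose

theorem calculus_spec [CompleteSpace X] (x : Fin n → X) : IsCalculus x (calculus x) :=
  (existsUnique_isCalculus x).choose_spec.1

end Calculus

end Krivine

/-- A (real) Banach sequence lattice: an ideal of the space of all real sequences that contains
the canonical sequences and is complete for a norm that respects the order of absolute values. -/
structure BanachSequenceLattice where
  carrier : Submodule ℝ (ℕ → ℝ)
  norm : carrier → ℝ
  norm_eq_zero : ∀ f, norm f = 0 ↔ f = 0
  norm_add_le : ∀ f g, norm (f + g) ≤ norm f + norm g
  norm_smul : ∀ (c : ℝ) (f), norm (c • f) = |c| * norm f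
  ideal : ∀ f g : ℕ → ℝ, g ∈ carrier → (∀ k, |f k| ≤ |g k|) → f ∈ carrier
  norm_mono : ∀ f g : carrier, (∀ k, |(f : ℕ → ℝ) k| ≤ |(g : ℕ → ℝ) k|) → norm f ≤ norm g
  complete : ∀ u : ℕ → carrier,
    (∀ ε > 0, ∃ N, ∀ m ≥ N, ∀ k ≥ N, norm (u m - u k) < ε) →
      ∃ f, Tendsto (fun m => norm (u m - f)) atTop (𝓝 0)
  single_mem : ∀ k, Pi.single k (1 : ℝ) ∈ carrier

namespace BanachSequenceLattice

variable (Y : BanachSequenceLattice)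

/-- The finite sequence `(t_1, …, t_n)` continued by zeros. -/
def extend {n : ℕ} (t : Fin n → ℝ) : ℕ → ℝ := fun k => if h : k < n then t ⟨k, h⟩ else 0

theorem extend_mem {n : ℕ} (t : Fin n → ℝ) : extend t ∈ Y.carrier := by
  have : extend t = ∑ j : Fin n, t j • (Pi.single (j : ℕ) (1 : ℝ) : ℕ → ℝ) := by
    funext k
    rw [Finset.sum_apply]
    by_cases h : k < n
    · rw [Finset.sum_eq_single (⟨k, h⟩ : Fin n)]
      · simp [extend, h]
      · intro j _ hj
        have : k ≠ (j : ℕ) := fun e => hj (Fin.ext e.symm)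
        simp [this]
      · simp
    · rw [Finset.sum_eq_zero]
      · simp [extend, h]
      · intro j _
        have : k ≠ (j : ℕ) := fun e => h (e ▸ j.2)
        simp [this]
  rw [this]
  exact Submodule.sum_mem _ fun j _ => Submodule.smul_mem _ _ (Y.single_mem j)

/-- The norm of `Y` on `ℝⁿ`. -/
def finNorm {n : ℕ} (t : Fin n → ℝ) : ℝ := Y.norm ⟨extend t, Y.extend_mem t⟩

theorem finNorm_add_le {n : ℕ} (s t : Fin n → ℝ) :
    Y.finNorm (s + t) ≤ Y.finNorm s + Y.finNorm t := by
  have : (⟨extend (s + t), Y.extend_mem _⟩ : Y.carrier) =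
      ⟨extend s, Y.extend_mem _⟩ + ⟨extend t, Y.extend_mem _⟩ := by
    refine Subtype.ext (funext fun k => ?_)
    by_cases h : k < n <;> simp [extend, h]
  unfold finNorm
  rw [this]
  exact Y.norm_add_le _ _

theorem finNorm_smul {n : ℕ} (c : ℝ) (t : Fin n → ℝ) :
    Y.finNorm (c • t) = |c| * Y.finNorm t := by
  have : (⟨extend (c • t), Y.extend_mem _⟩ : Y.carrier) = c • ⟨extend t, Y.extend_mem _⟩ := by
    refine Subtype.ext (funext fun k => ?_)
    by_cases h : k < n <;> simp [extend, h]
  unfold finNorm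
  rw [this]
  exact Y.norm_smul _ _

theorem finNorm_le {n : ℕ} (t : Fin n → ℝ) : Y.finNorm t ≤ ‖t‖ * Y.finNorm (1 : Fin n → ℝ) := by
  rw [← abs_of_nonneg (norm_nonneg t), ← Y.finNorm_smul]
  refine Y.norm_mono _ _ fun k => ?_
  by_cases h : k < n
  · simpa [extend, h] using norm_le_pi_norm t ⟨k, h⟩
  · simp [extend, h]

theorem finNorm_nonneg {n : ℕ} (t : Fin n → ℝ) : 0 ≤ Y.finNorm t := by
  have h1 := Y.finNorm_add_le t ((-1 : ℝ) • t)
  have h2 := Y.finNorm_smul 0 t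
  rw [Y.finNorm_smul] at h1
  simp only [neg_smul, one_smul, add_neg_cancel, abs_neg, abs_one, one_mul, zero_smul, abs_zero,
    zero_mul] at h1 h2
  linarith

theorem continuous_finNorm (n : ℕ) : Continuous (Y.finNorm : (Fin n → ℝ) → ℝ) := by
  refine (LipschitzWith.of_le_add_mul ⟨Y.finNorm (1 : Fin n → ℝ), Y.finNorm_nonneg _⟩
    fun s t => ?_).continuous
  have h1 := Y.finNorm_add_le t (s - t)
  have h2 := Y.finNorm_le (s - t)
  rw [add_sub_cancel] at h1
  rw [dist_eq_norm]
  have h3 : ‖s - t‖ * Y.finNorm (1 : Fin n → ℝ) = Y.finNorm (1 : Fin n → ℝ) * ‖s - t‖ :=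
    mul_comm _ _
  change _ ≤ _ + Y.finNorm (1 : Fin n → ℝ) * ‖s - t‖
  linarith

/-- The norm of `Y` on `ℝⁿ`, as an element of `H_n`. -/
def normFun (n : ℕ) : Krivine.HomogFun n :=
  ⟨⟨Y.finNorm, Y.continuous_finNorm n⟩, by
    intro c hc t
    simp [Y.finNorm_smul, abs_of_nonneg hc]⟩

section Operators

variable {X : Type*} [NormedAddCommGroup X] [NormedSpace ℝ X] [Lattice X]
  [IsOrderedAddMonoid X] [IsOrderedModule ℝ X] [HasSolidNorm X] [CompleteSpace X]
variable {W : Type*} [NormedAddCommGroup W] [NormedSpace ℝ W] [Lattice W]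
  [IsOrderedAddMonoid W] [IsOrderedModule ℝ W] [HasSolidNorm W] [CompleteSpace W]

/-- The element `‖(x_1, …, x_n)‖_Y` of `X`, given by Krivine's functional calculus. -/
noncomputable def latticeNorm {n : ℕ} (x : Fin n → X) : X := Krivine.calculus x (Y.normFun n)

/-- `T` is `Y`-regular, i.e. belongs to `Λ_Y(X, W)`. -/
def IsYRegular (T : X →ₗ[ℝ] W) : Prop :=
  ∃ C : ℝ, 0 < C ∧ ∀ (n : ℕ) (x : Fin n → X),
    ‖Y.latticeNorm (fun j => T (x j))‖ ≤ C * ‖Y.latticeNorm x‖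

end Operators

end BanachSequenceLattice

/-- A linear operator is positive if it maps the positive cone into the positive cone. -/
def IsPositiveOperator {X W : Type*} [AddCommGroup X] [Module ℝ X] [Lattice X] [AddCommGroup W]
    [Module ℝ W] [Lattice W] (P : X →ₗ[ℝ] W) : Prop := ∀ x, 0 ≤ x → 0 ≤ P x

/-- A linear operator is regular if it is a difference of two positive operators. -/
def IsRegularOperator {X W : Type*} [AddCommGroup X] [Module ℝ X] [Lattice X] [AddCommGroup W]
    [Module ℝ W] [Lattice W] (T : X →ₗ[ℝ] W) : Prop :=
  ∃ P Q : X →ₗ[ℝ] W, IsPositiveOperator P ∧ IsPositiveOperator Q ∧ T = P - Q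

/-! ### Order properties of the functional calculus -/

namespace Krivine

variable {X : Type*} [NormedAddCommGroup X] [NormedSpace ℝ X] [Lattice X]
  [IsOrderedAddMonoid X] [IsOrderedModule ℝ X] [HasSolidNorm X]
variable {n : ℕ}

/-! By Hahn–Banach, the norm of `Y` on `ℝⁿ` is the pointwise maximum of the linear forms below it.
The calculus sends a linear form with coefficients `v` to `∑ v_j x_j`, and linear operators commute
with such sums. Hence, for positive `P` and every form below the norm, `∑ v_j P x_j = P (∑ v_j x_j)
≤ P ‖x‖_Y`, because the calculus at `x` is monotone.

The calculus respects only finite maxima, so the supremum has to be made finite. Compactness of the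
unit sphere provides finitely many forms whose maximum is within `ε` of the norm there, hence within
`ε ‖t‖` everywhere by homogeneity. The calculus at `Px` then gives `‖Px‖_Y ≤ P ‖x‖_Y + ε e`, with
`e` the image of the maximum norm, and `ε → 0` finishes the proof. No continuity of `P` enters,
since approximation takes place only in `W`.

The argument uses only `T u ≤ R |u|` with `R` positive, which is the form of `latticeNorm_map_le`.
For `T = P - Q` this holds with `R = P + Q`. Positive operators on a Banach lattice are bounded
(`IsPositiveOperator.exists_bound`), so taking norms gives `Y`-regularity. -/

theorem IsCalculus.mono {x : Fin n → X} {τ : HomogFun n →ₗ[ℝ] X} (h : IsCalculus x τ)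
    {f g : HomogFun n} (hfg : ∀ t, (f : C(Fin n → ℝ, ℝ)) t ≤ (g : C(Fin n → ℝ, ℝ)) t) :
    τ f ≤ τ g := by
  have : 0 ≤ τ (g - f) := h.nonneg fun t => sub_nonneg.2 (hfg t)
  rwa [map_sub, sub_nonneg] at this

/-- Finitely many functions whose images lie below `z ≥ 0` have a common upper bound whose image
lies below `z`. -/
theorem IsCalculus.exists_upper_bound {x : Fin n → X} {τ : HomogFun n →ₗ[ℝ] X}
    (h : IsCalculus x τ) {z : X} (hz : 0 ≤ z) {ι : Type*} (F : Finset ι) (f : ι → HomogFun n)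
    (hf : ∀ i ∈ F, τ (f i) ≤ z) :
    ∃ g : HomogFun n, τ g ≤ z ∧
      ∀ i ∈ F, ∀ t, (f i : C(Fin n → ℝ, ℝ)) t ≤ (g : C(Fin n → ℝ, ℝ)) t := by
  classical
  induction F using Finset.induction_on with
  -- The empty family is bounded by the zero function, and only here is `0 ≤ z` needed. This case
  -- does occur: for `n = 0` the sphere is empty.
  | empty => exact ⟨0, by rwa [map_zero], by simp⟩
  | insert a s _ ih =>
    obtain ⟨g, hg, hfg⟩ := ih fun i hi => hf i (Finset.mem_insert_of_mem hi)
    refine ⟨HomogFun.sup (f a) g, ?_, fun i hi t => ?_⟩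
    · rw [h.map_sup]
      exact sup_le (hf a (Finset.mem_insert_self a s)) hg
    · rcases Finset.mem_insert.1 hi with rfl | hi
      · exact le_max_left _ _
      · exact (hfg i hi t).trans (le_max_right _ _)

/-- The linear form with coefficients `v` as an element of `H_n`. -/
def linForm (v : Fin n → ℝ) : HomogFun n := ∑ j, v j • HomogFun.proj j

theorem linForm_apply (v t : Fin n → ℝ) :
    (linForm v : C(Fin n → ℝ, ℝ)) t = ∑ j, v j * t j := by
  simp only [linForm, AddSubmonoidClass.coe_finsetSum, ContinuousMap.sum_apply]
  rfl

theorem IsCalculus.map_linForm {x : Fin n → X} {τ : HomogFun n →ₗ[ℝ] X} (h : IsCalculus x τ)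
    (v : Fin n → ℝ) : τ (linForm v) = ∑ j, v j • x j := by
  simp [linForm, h.map_proj]

end Krivine

/-! ### Positive operators and their automatic boundedness -/

theorem IsPositiveOperator.mono {X W : Type*} [AddCommGroup X] [Module ℝ X] [Lattice X]
    [IsOrderedAddMonoid X] [AddCommGroup W] [Module ℝ W] [Lattice W] [IsOrderedAddMonoid W]
    {P : X →ₗ[ℝ] W} (hP : IsPositiveOperator P) {x y : X} (h : x ≤ y) : P x ≤ P y := by
  have := hP (y - x) (sub_nonneg.2 h)
  rwa [map_sub, sub_nonneg] at this

theorem IsPositiveOperator.abs_map_le {X W : Type*} [AddCommGroup X] [Module ℝ X] [Lattice X]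
    [IsOrderedAddMonoid X] [AddCommGroup W] [Module ℝ W] [Lattice W] [IsOrderedAddMonoid W]
    {P : X →ₗ[ℝ] W} (hP : IsPositiveOperator P) (x : X) : |P x| ≤ P |x| := by
  refine abs_le'.2 ⟨hP.mono (le_abs_self x), ?_⟩
  rw [← map_neg]
  exact hP.mono (neg_le_abs x)

theorem IsPositiveOperator.add {X W : Type*} [AddCommGroup X] [Module ℝ X] [Lattice X]
    [AddCommGroup W] [Module ℝ W] [Lattice W] [IsOrderedAddMonoid W]
    {P Q : X →ₗ[ℝ] W} (hP : IsPositiveOperator P) (hQ : IsPositiveOperator Q) :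
    IsPositiveOperator (P + Q) := fun x hx => add_nonneg (hP x hx) (hQ x hx)

section Operators

variable {X : Type*} [NormedAddCommGroup X] [NormedSpace ℝ X] [Lattice X]
  [IsOrderedAddMonoid X] [IsOrderedModule ℝ X] [HasSolidNorm X] [CompleteSpace X]
variable {W : Type*} [NormedAddCommGroup W] [NormedSpace ℝ W] [Lattice W]
  [IsOrderedAddMonoid W] [IsOrderedModule ℝ W] [HasSolidNorm W]

/-- Positive operators between normed lattices are bounded if the domain is complete. -/
theorem IsPositiveOperator.exists_bound {P : X →ₗ[ℝ] W} (hP : IsPositiveOperator P) :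
    ∃ C : ℝ, 0 < C ∧ ∀ x, ‖P x‖ ≤ C * ‖x‖ := by
  by_contra! hcon
  -- With the factor `4 ^ k`, rescaling `u k` to norm `2 ^ (-k)` makes the vectors summable while
  -- their images still have norm at least `2 ^ k`.
  choose u hu using fun k : ℕ => hcon (4 ^ k) (by positivity)
  have hu0 : ∀ k, 0 < ‖u k‖ := by
    intro k
    refine norm_pos_iff.2 fun h => ?_
    have := hu k
    simp [h] at this
  -- Absolute values make the terms positive, so that the sum of the series dominates each of them
  -- in the order; its image would then have norm at least `2 ^ k` for every `k`.
  let y : ℕ → X := fun k => |((1 / 2 : ℝ) ^ k * ‖u k‖⁻¹) • u k|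
  have hy : ∀ k, ‖y k‖ = (1 / 2 : ℝ) ^ k := by
    intro k
    rw [norm_abs_eq_norm, norm_smul, Real.norm_of_nonneg (by positivity), mul_assoc,
      inv_mul_cancel₀ (hu0 k).ne', mul_one]
  have hsum : Summable y := Summable.of_norm (by
    simpa only [hy] using summable_geometric_of_lt_one (by norm_num) (by norm_num))
  have hle : ∀ k, (2 : ℝ) ^ k ≤ ‖P (∑' i, y i)‖ := by
    intro k
    have h1 : y k ≤ ∑' i, y i := hsum.le_tsum k fun i _ => abs_nonneg _
    have h2 : |P (((1 / 2 : ℝ) ^ k * ‖u k‖⁻¹) • u k)| ≤ |P (∑' i, y i)| :=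
      (hP.abs_map_le _).trans ((hP.mono h1).trans (le_abs_self _))
    refine le_trans ?_ (norm_le_norm_of_abs_le_abs h2)
    rw [map_smul, norm_smul, Real.norm_of_nonneg (by positivity)]
    calc (2 : ℝ) ^ k = (1 / 2 : ℝ) ^ k * ‖u k‖⁻¹ * (4 ^ k * ‖u k‖) := by
          have h4 : (4 : ℝ) ^ k = 2 ^ k * 2 ^ k := by rw [← mul_pow]; norm_num
          have := (hu0 k).ne'
          rw [h4, one_div, inv_pow]
          field_simp
      _ ≤ _ := mul_le_mul_of_nonneg_left (hu k).le (by positivity)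
  obtain ⟨k, hk⟩ := pow_unbounded_of_one_lt ‖P (∑' i, y i)‖ (one_lt_two (α := ℝ))
  exact absurd (hle k) (not_le.2 hk)

end Operators

/-! ### The norm of `Y` as a supremum of linear forms -/

namespace BanachSequenceLattice

variable (Y : BanachSequenceLattice)

/-- A linear form dominated by the norm of `Y` that attains it at `s`. -/
theorem exists_norming_form {n : ℕ} (s : Fin n → ℝ) :
    ∃ v : Fin n → ℝ, (∀ t, ∑ j, v j * t j ≤ Y.finNorm t) ∧ ∑ j, v j * s j = Y.finNorm s := by
  have hN0 : Y.finNorm (0 : Fin n → ℝ) = 0 := by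
    have := Y.finNorm_smul 0 (0 : Fin n → ℝ)
    simpa using this
  -- The form `c s ↦ c ‖s‖_Y` on the line through `s`. It is well defined, even for `s = 0`, because
  -- `c s = 0` forces `|c| ‖s‖_Y = 0`.
  let f : (Fin n → ℝ) →ₗ.[ℝ] ℝ := LinearPMap.mkSpanSingleton' s (Y.finNorm s) (by
    intro c hc
    have := Y.finNorm_smul c s
    rw [hc, hN0] at this
    rcases mul_eq_zero.1 this.symm with h | h
    · simp [abs_eq_zero.1 h]
    · simp [h])
  obtain ⟨g, hg, hgN⟩ := exists_extension_of_le_sublinear f Y.finNorm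
    (fun c hc t => by rw [Y.finNorm_smul, abs_of_pos hc]) Y.finNorm_add_le (by
      rintro ⟨t, ht⟩
      obtain ⟨c, rfl⟩ := Submodule.mem_span_singleton.1 ht
      rw [LinearPMap.mkSpanSingleton'_apply, Y.finNorm_smul]
      exact mul_le_mul_of_nonneg_right (le_abs_self c) (Y.finNorm_nonneg s))
  have hgv : ∀ t, ∑ j, g (Pi.single j 1) * t j = g t := by
    intro t
    conv_rhs => rw [pi_eq_sum_univ' t]
    simp [mul_comm]
  refine ⟨fun j => g (Pi.single j 1), fun t => (hgv t).trans_le (hgN t), ?_⟩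
  rw [hgv, hg ⟨s, Submodule.mem_span_singleton_self s⟩]
  exact LinearPMap.mkSpanSingleton'_apply_self _ _ _ _

/-- Up to `ε` on the sphere, the norm of `Y` is the maximum of finitely many linear forms. -/
theorem exists_finite_forms (n : ℕ) {ε : ℝ} (hε : 0 < ε) :
    ∃ (F : Finset (Krivine.Sph n)) (v : Krivine.Sph n → Fin n → ℝ),
      (∀ s t, ∑ j, v s j * t j ≤ Y.finNorm t) ∧
      ∀ t : Krivine.Sph n, ∃ s ∈ F, Y.finNorm (t : Fin n → ℝ) ≤ ∑ j, v s j * t.1 j + ε := by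
  choose v hv hvs using fun s : Krivine.Sph n => Y.exists_norming_form (s : Fin n → ℝ)
  -- The set where the form attached to `s` comes within `ε` of the norm is open and contains `s`,
  -- where the two agree.
  obtain ⟨F, hF⟩ := isCompact_univ.elim_finite_subcover
    (fun s : Krivine.Sph n => {t : Krivine.Sph n | Y.finNorm t.1 < ∑ j, v s j * t.1 j + ε})
    (fun s => isOpen_lt ((Y.continuous_finNorm n).comp continuous_subtype_val)
      ((continuous_finsetSum _ fun j _ => continuous_const.mul
        ((continuous_apply j).comp continuous_subtype_val)).add continuous_const))
    (fun s _ => Set.mem_iUnion.2 ⟨s, by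
      change Y.finNorm s.1 < _
      rw [hvs]
      linarith⟩)
  refine ⟨F, v, hv, fun t => ?_⟩
  obtain ⟨s, hs, hst⟩ := Set.mem_iUnion₂.1 (hF (Set.mem_univ t))
  exact ⟨s, hs, le_of_lt hst⟩

/-! ### Domination of `Y`-norms in Banach lattices -/

section Operators

variable {X : Type*} [NormedAddCommGroup X] [NormedSpace ℝ X] [Lattice X]
  [IsOrderedAddMonoid X] [IsOrderedModule ℝ X] [HasSolidNorm X] [CompleteSpace X]
variable {W : Type*} [NormedAddCommGroup W] [NormedSpace ℝ W] [Lattice W]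
  [IsOrderedAddMonoid W] [IsOrderedModule ℝ W] [HasSolidNorm W] [CompleteSpace W]

theorem latticeNorm_nonneg {n : ℕ} (x : Fin n → X) : 0 ≤ Y.latticeNorm x :=
  (Krivine.calculus_spec x).nonneg fun t => Y.finNorm_nonneg t

/-- Monotonicity of the calculus, applied to a linear form below the norm. The absolute value costs
nothing: the norm is even, so the negated form lies below it too. -/
theorem abs_sum_smul_le_latticeNorm {n : ℕ} (x : Fin n → X) {v : Fin n → ℝ}
    (hv : ∀ t, ∑ j, v j * t j ≤ Y.finNorm t) : |∑ j, v j • x j| ≤ Y.latticeNorm x := by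
  have h := Krivine.calculus_spec x
  rw [← h.map_linForm]
  refine abs_le'.2 ⟨h.mono fun t => ?_, ?_⟩
  · rw [Krivine.linForm_apply]
    exact hv t
  · rw [← map_neg]
    refine h.mono fun t => ?_
    have h1 := hv ((-1 : ℝ) • t)
    rw [Y.finNorm_smul] at h1
    have h2 : (((-Krivine.linForm v : Krivine.HomogFun n)) : C(Fin n → ℝ, ℝ)) t =
        ∑ j, v j * ((-1 : ℝ) • t) j := by
      change -((Krivine.linForm v : C(Fin n → ℝ, ℝ)) t) = _
      simp [Krivine.linForm_apply]
    rw [h2]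
    rwa [abs_neg, abs_one, one_mul] at h1

/-- An operator dominated by a positive operator `R` satisfies
`‖(T x_1, …, T x_n)‖_Y ≤ R ‖(x_1, …, x_n)‖_Y`. -/
theorem latticeNorm_map_le {T R : X →ₗ[ℝ] W} (hR : IsPositiveOperator R)
    (hT : ∀ u, T u ≤ R |u|) {n : ℕ} (x : Fin n → X) :
    Y.latticeNorm (fun j => T (x j)) ≤ R (Y.latticeNorm x) := by
  have h := Krivine.calculus_spec fun j => T (x j)
  set τ := Krivine.calculus fun j => T (x j) with hτ
  set e := τ (Krivine.maxFun n)
  have key : ∀ ε : ℝ, 0 < ε → Y.latticeNorm (fun j => T (x j)) ≤ R (Y.latticeNorm x) + ε • e := by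
    intro ε hε
    obtain ⟨F, v, hv, hF⟩ := Y.exists_finite_forms n hε
    -- `g` majorizes the finitely many approximating forms, while its image stays below `R ‖x‖_Y`.
    obtain ⟨g, hg, hfg⟩ := h.exists_upper_bound (hR _ (Y.latticeNorm_nonneg x)) F
      (fun s => Krivine.linForm (v s)) fun s _ => by
        rw [h.map_linForm]
        calc ∑ j, v s j • T (x j) = T (∑ j, v s j • x j) := by simp
          _ ≤ R |∑ j, v s j • x j| := hT _
          _ ≤ _ := hR.mono (Y.abs_sum_smul_le_latticeNorm x (hv s))
    -- On the sphere the norm of `Y` exceeds `g` by at most `ε`; homogeneity turns this into a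
    -- multiple of the maximum norm, whose image is `ε • e`.
    have hle : ∀ t, ((Y.normFun n - g : Krivine.HomogFun n) : C(Fin n → ℝ, ℝ)) t ≤
        ε * ‖t‖ := Krivine.homog_le fun t => by
      obtain ⟨s, hs, hst⟩ := hF t
      have h1 := hfg s hs t.1
      rw [Krivine.linForm_apply] at h1
      change Y.finNorm t.1 - (g : C(Fin n → ℝ, ℝ)) t.1 ≤ ε
      linarith
    have h2 : τ (Y.normFun n - g) ≤ τ (ε • Krivine.maxFun n) := h.mono hle
    rw [map_sub, map_smul, sub_le_iff_le_add'] at h2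
    exact h2.trans (add_le_add_left hg _)
  have hlim : Tendsto (fun ε : ℝ => R (Y.latticeNorm x) + ε • e) (𝓝[>] 0)
      (𝓝 (R (Y.latticeNorm x))) := by
    have : Continuous fun ε : ℝ => R (Y.latticeNorm x) + ε • e := by fun_prop
    simpa using (this.tendsto 0).mono_left nhdsWithin_le_nhds
  -- The order of a Banach lattice is closed, so the inequality survives the limit.
  exact ge_of_tendsto hlim (eventually_mem_nhdsWithin.mono key)

end Operators

end BanachSequenceLattice

/-! ### The proposition -/

theorem mainTheorem7 (Y : BanachSequenceLattice)
    {X : Type*} [NormedAddCommGroup X] [NormedSpace ℝ X] [Lattice X] [IsOrderedAddMonoid X]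
    [IsOrderedModule ℝ X] [HasSolidNorm X] [CompleteSpace X]
    {W : Type*} [NormedAddCommGroup W] [NormedSpace ℝ W] [Lattice W] [IsOrderedAddMonoid W]
    [IsOrderedModule ℝ W] [HasSolidNorm W] [CompleteSpace W] :
    (∀ T : X →ₗ[ℝ] W, IsRegularOperator T → Y.IsYRegular T) ∧
    (∀ P : X →ₗ[ℝ] W, IsPositiveOperator P → ∀ (n : ℕ) (x : Fin n → X),
      Y.latticeNorm (fun j => P (x j)) ≤ P (Y.latticeNorm x)) := by
  refine ⟨?_, fun P hP n x => Y.latticeNorm_map_le hP (fun u => hP.mono (le_abs_self u)) x⟩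
  rintro T ⟨P, Q, hP, hQ, rfl⟩
  -- The regularity constant is a norm bound for the positive operator `P + Q`, which dominates `P -
  -- Q`.
  obtain ⟨C, hC, hb⟩ := (hP.add hQ).exists_bound
  refine ⟨C, hC, fun n x => le_trans (norm_le_norm_of_abs_le_abs ?_) (hb (Y.latticeNorm x))⟩
  rw [abs_of_nonneg (Y.latticeNorm_nonneg _)]
  refine (Y.latticeNorm_map_le (hP.add hQ) (fun u => ?_) x).trans (le_abs_self _)
  -- `P u - Q u ≤ P |u| + |Q u| ≤ (P + Q) |u|`.
  have h1 := hP.mono (le_abs_self u)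
  have h2 := (neg_le_abs (Q u)).trans (hQ.abs_map_le u)
  rw [LinearMap.sub_apply, LinearMap.add_apply, sub_eq_add_neg]
  exact add_le_add h1 h2
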